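/- Let $\mu$ be a probability measure on $\mathbb{R}$ satisfying condition (H): there are $M>0$ and $q\in(0,1)$ such that a random variable $\xi$ with law $\mu$ satisfies $$\sup_{u\in\mathbb{R}}\mathbb{P}(|\xi-u|\le 1)\le 1-q\qquad\text{and}\qquad \mathbb{P}(|\xi|>M)\le q/2.$$ Then there are a constant $C>0$ and a real sequence $o(1)$ (that is, a sequence indexed by $n$ that tends to $0$ as $n\to\infty$), both depending only on $\mu$, such that the following holds. Let $\xi_0,\xi_1,\xi_2,\dots$ be independent real random variables with common law $\mu$, and for $n\ge 1$ let $\mathcal{C}_n$ be the $n\times n$ circulant matrix with first row $(\xi_0,\xi_1,\dots,\xi_{n-1})$, i.e. with $(i,j)$ entry $\xi_{(j-i)\bmod n}$, and let $\sigma_{\min}(\mathcal{C}_n)$ be its smallest singular value (the square root of the smallest eigenvalue of $\mathcal{C}_n^{T}\mathcal{C}_n$). Then for every $\varepsilon>0$ and every $\rho\in(0,1/4)$, for all sufficiently large $n$, $$\mathbb{P}\bigl(\sigma_{\min}(\mathcal{C}_n)\le \varepsilon n^{-\rho}\bigr)\le C\left(\frac{\varepsilon^2+\varepsilon}{n^{2\rho}}+\frac{1}{n^{1/2-o(1)}}\right).$$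 -/

import Mathlib

open MeasureTheory ProbabilityTheory Filter Topology
open scoped ENNReal

/-- Condition (H) for the law `μ` of a real random variable `ξ`: for some `M > 0` and `q ∈ (0,1)`,
`sup_u P(|ξ - u| ≤ 1) ≤ 1 - q` and `P(|ξ| > M) ≤ q / 2`. -/
def ConditionH (μ : Measure ℝ) : Prop :=
  ∃ M q : ℝ, 0 < M ∧ 0 < q ∧ q < 1 ∧
    (⨆ u : ℝ, μ {x | |x - u| ≤ 1}) ≤ ENNReal.ofReal (1 - q) ∧
    μ {x | |x| > M} ≤ ENNReal.ofReal (q / 2)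

/-- The `n × n` circulant matrix with first row `(x 0, …, x (n - 1))`: its `(i, j)` entry is
`x ((j - i) mod n)`. (Mathlib's `Matrix.circulant` prescribes the first column.) -/
def rowCirculant (n : ℕ) (x : ℕ → ℝ) : Matrix (Fin n) (Fin n) ℝ :=
  (Matrix.circulant fun k : Fin n => x k).transpose

/-- The smallest singular value of a square real matrix `A`, that is, the last of the `n` square
roots of the eigenvalues of `Aᵀ A` listed in decreasing order. (Singular values are indexed from
`0`; the value for the `0 × 0` matrix is irrelevant.) -/
noncomputable def sigmaMin {n : ℕ} (A : Matrix (Fin n) (Fin n) ℝ) : ℝ :=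
  (Matrix.toEuclideanLin A).singularValues (n - 1)

/-! The smallest singular value is the modulus of some eigenvalue `∑ ξ_j ζ^j`, `ζ = exp(2πik/n)`, so
a union bound over `k` reduces the theorem to small-ball estimates at radius `t = ε n^(-ρ)`. These
come from Esseen's inequality, once the characteristic function of the eigenvalue is controlled for
`‖η‖ ≤ 1/t`. By symmetrization and (H), its modulus at `η` is at most `exp(-κB/2)`, where `B` bounds
`∑ (1 - cos⟨ζ^j, w⟩)` from below for all `w = xη` with `1 ≤ |x| ≤ L`.

If `‖w‖ ≤ π` and `ζ² ≠ 1`, this sum is of order `n‖w‖²`. If `‖w‖ ≥ 1`, some power `ζ^h` has `|ζ^h -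
1|` of order `1/‖w‖`, provided the order `n/gcd(k,n)` of `ζ` is at least `2π‖w‖`; differencing along
the shift by `h` brings the frequency back to unit size, and the sum is of order `n`
(`sum_one_sub_cos_inner_ge_of_one_le`).

A generic `k` thus contributes `O(t²/n)` plus an exponentially small term, in total `O(ε²/n^(2ρ))`
up to a negligible error. The exceptional `k` are treated at the fixed radius `L ≥ t`, where only
`‖w‖ ≤ 1` occurs: at most two `k` with `ζ² = 1` cost `O(n^(-1/2))` each, and the `k` of order below
`R = 2πL/t` cost `O(1/n)` each. There are at most `(R + 1)²` of the latter, which is at most `√n`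
eventually because `ρ < 1/4`. The argument gives the bound with `o(1) = 0` and without the term
linear in `ε`. -/

/-- The `k`-th eigenvalue of the circulant matrix with first row `(x 0, …, x (n - 1))`. -/
noncomputable def circulantEigenvalue (n k : ℕ) (x : ℕ → ℝ) : ℂ :=
  ∑ j ∈ Finset.range n, x j • Complex.exp (2 * Real.pi * Complex.I * k / n) ^ j

/-! ### Singular values of circulant matrices -/

theorem stdAddChar_mul_eq_exp_pow (n : ℕ) [NeZero n] (k j : ZMod n) :
    ZMod.stdAddChar (k * j) = Complex.exp (2 * Real.pi * Complex.I * k.val / n) ^ j.val := by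
  have h : k * j = ((k.val * j.val : ℤ) : ZMod n) := by simp
  rw [h, ZMod.stdAddChar_coe, ← Complex.exp_nat_mul]
  push_cast
  ring_nf

theorem circulantEigenvalue_eq_sum_stdAddChar (N : ℕ) (k : ZMod (N + 1)) (x : ℕ → ℝ) :
    circulantEigenvalue (N + 1) k.val x =
      ∑ j : ZMod (N + 1), (x j.val : ℂ) * ZMod.stdAddChar (k * j) := by
  simp only [stdAddChar_mul_eq_exp_pow]
  rw [circulantEigenvalue, Finset.sum_range]
  simp only [Complex.real_smul]
  rfl

/-- An eigenvalue of `AᵀA`, for the circulant matrix `A` with entries `a (j - i)`, is the squared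
modulus of a value of the Fourier transform of `a`. -/
theorem exists_eigenvalue_transpose_mul_self_eq {n : ℕ} [NeZero n] (a : ZMod n → ℝ)
    (V : ZMod n → ℂ) (hV : V ≠ 0) (s : ℂ)
    (hs : ∀ i, ∑ j, (a (i - j) : ℂ) * ∑ p, (a (p - j) : ℂ) * V p = s * V i) :
    ∃ k : ZMod n, s = (‖∑ j, (a j : ℂ) * ZMod.stdAddChar (k * j)‖ : ℂ) ^ 2 := by
  have hV2 : ZMod.dft V ≠ 0 := by simpa using hV
  obtain ⟨k₀, hk₀⟩ := Function.ne_iff.1 hV2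
  set k := -k₀ with hk
  have hc : ∑ j, ZMod.stdAddChar (k * j) * V j ≠ 0 := by
    rw [ZMod.dft_apply] at hk₀
    simpa [hk, mul_comm] using hk₀
  refine ⟨k, ?_⟩
  set l := ∑ j, (a j : ℂ) * ZMod.stdAddChar (k * j) with hl
  have h1 : ∀ j : ZMod n, ∑ i, ZMod.stdAddChar (k * i) * (a (i - j) : ℂ) =
      l * ZMod.stdAddChar (k * j) := by
    intro j
    rw [hl, Finset.sum_mul, ← Equiv.sum_comp (Equiv.addRight j)]
    refine Finset.sum_congr rfl fun i _ => ?_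
    simp only [Equiv.coe_addRight, add_sub_cancel_right, mul_add, AddChar.map_add_eq_mul]
    ring
  have h2 : ∀ j : ZMod n, ∑ i, ZMod.stdAddChar (k * i) * (a (j - i) : ℂ) =
      (starRingEnd ℂ) l * ZMod.stdAddChar (k * j) := by
    intro j
    rw [hl, map_sum, Finset.sum_mul, ← Equiv.sum_comp (Equiv.subLeft j)]
    refine Finset.sum_congr rfl fun i _ => ?_
    rw [Equiv.subLeft_apply, sub_sub_cancel, mul_sub, map_mul, Complex.conj_ofReal,
      sub_eq_add_neg, AddChar.map_add_eq_mul, AddChar.map_neg_eq_conj]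
    ring
  -- Pair the eigenvector equation with a character on which the Fourier coefficient of `V` does not
  -- vanish: the two convolutions act by `l` and its conjugate.
  refine mul_right_cancel₀ hc ?_
  calc s * ∑ j, ZMod.stdAddChar (k * j) * V j
      = ∑ i, ZMod.stdAddChar (k * i) * ∑ j, (a (i - j) : ℂ) * ∑ p, (a (p - j) : ℂ) * V p := by
        rw [Finset.mul_sum]
        exact Finset.sum_congr rfl fun i _ => by rw [hs]; ring
    _ = ∑ j, (∑ i, ZMod.stdAddChar (k * i) * (a (i - j) : ℂ)) * ∑ p, (a (p - j) : ℂ) * V p := by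
        simp_rw [Finset.sum_mul]
        rw [Finset.sum_comm]
        refine Finset.sum_congr rfl fun i _ => ?_
        rw [Finset.mul_sum]
        exact Finset.sum_congr rfl fun j _ => by ring
    _ = l * ∑ p, (∑ j, ZMod.stdAddChar (k * j) * (a (p - j) : ℂ)) * V p := by
        simp_rw [h1, Finset.mul_sum, Finset.sum_mul, Finset.mul_sum]
        rw [Finset.sum_comm]
        exact Finset.sum_congr rfl fun p _ => Finset.sum_congr rfl fun i _ => by ring
    _ = (‖l‖ : ℂ) ^ 2 * ∑ j, ZMod.stdAddChar (k * j) * V j := by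
        simp_rw [h2, ← Complex.mul_conj', Finset.mul_sum]
        exact Finset.sum_congr rfl fun p _ => by ring

/-- The smallest singular value of a circulant matrix is the modulus of one of its eigenvalues. -/
theorem exists_norm_circulantEigenvalue_eq (n : ℕ) (hn : n ≠ 0) (x : ℕ → ℝ) :
    ∃ k < n, ‖circulantEigenvalue n k x‖ = sigmaMin (rowCirculant n x) := by
  -- In the form `N + 1`, `ZMod` unfolds to `Fin`, which lets `rfl` match the matrix entries with
  -- the convolutions below.
  obtain ⟨N, rfl⟩ := Nat.exists_eq_succ_of_ne_zero hn
  set A := rowCirculant (N + 1) x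
  obtain ⟨v, hv, hv0⟩ := ((Matrix.toEuclideanLin A).hasEigenvalue_adjoint_comp_self_sq_singularValues
    (n := N) (by simp)).exists_hasEigenvector
  rw [Module.End.mem_eigenspace_iff] at hv
  change _ = sigmaMin A ^ 2 • v at hv
  replace hv : A.transpose.mulVec (A.mulVec v) = sigmaMin A ^ 2 • (v : Fin (N + 1) → ℝ) := by
    rw [← Matrix.toEuclideanLin_conjTranspose_eq_adjoint] at hv
    have := congrArg (fun w : EuclideanSpace ℝ (Fin (N + 1)) => (w : Fin (N + 1) → ℝ)) hv
    simpa using this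
  obtain ⟨k, hk⟩ := exists_eigenvalue_transpose_mul_self_eq (n := N + 1) (fun j => x j.val)
    (fun i => ((v : Fin (N + 1) → ℝ) i : ℂ))
    (fun h => hv0 <| by
      ext i
      exact Complex.ofReal_eq_zero.1 (congrFun h i))
    ((sigmaMin A : ℂ) ^ 2) (fun i => by
      have h3 : ((A.transpose.mulVec (A.mulVec v) i : ℝ) : ℂ) =
        ((sigmaMin A ^ 2 * (v : Fin (N + 1) → ℝ) i : ℝ) : ℂ) := by rw [hv]; rfl
      rw [Complex.ofReal_mul, Complex.ofReal_pow] at h3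
      refine Eq.trans ?_ h3
      simp only [Matrix.mulVec, dotProduct, Complex.ofReal_sum, Complex.ofReal_mul]
      rfl)
  refine ⟨k.val, ZMod.val_lt k, ?_⟩
  rw [← circulantEigenvalue_eq_sum_stdAddChar] at hk
  have h2 : ‖circulantEigenvalue (N + 1) k.val x‖ ^ 2 = sigmaMin A ^ 2 := by exact_mod_cast hk.symm
  exact (pow_left_inj₀ (norm_nonneg _) (LinearMap.singularValues_nonneg _ _) two_ne_zero).1 h2

/-! ### Cosine sums over the powers of a root of unity -/

theorem sum_range_pow_add_eq {M : Type*} [AddCommMonoid M] {n : ℕ} {ζ : ℂ} (hζ : ζ ^ n = 1)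
    (G : ℂ → M) (h : ℕ) :
    ∑ j ∈ Finset.range n, G (ζ ^ (j + h)) = ∑ j ∈ Finset.range n, G (ζ ^ j) := by
  induction h with
  | zero => simp
  | succ h ih =>
    rw [← ih]
    cases n with
    | zero => simp
    | succ n =>
      rw [Finset.sum_range_succ, Finset.sum_range_succ' (fun j => G (ζ ^ (j + h)))]
      congr 1
      · exact Finset.sum_congr rfl fun j _ => by congr 2; ring
      · rw [← add_assoc, add_right_comm, pow_add, hζ, one_mul, zero_add]

/-- By the double-angle formula each term is `‖w‖²/2` plus an oscillating part; the oscillating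
parts form a geometric sum of ratio `conj ζ² ≠ 1`, which vanishes. -/
theorem sum_inner_pow_sq {n : ℕ} {ζ : ℂ} (hζ : ζ ^ n = 1) (hζ1 : ‖ζ‖ = 1) (hζ2 : ζ ^ 2 ≠ 1)
    (w : ℂ) : ∑ j ∈ Finset.range n, inner ℝ (ζ ^ j) w ^ 2 = n * ‖w‖ ^ 2 / 2 := by
  have h1 : ∀ j : ℕ, inner ℝ (ζ ^ j) w ^ 2 =
      ‖w‖ ^ 2 / 2 + (w ^ 2 * ((starRingEnd ℂ) ζ ^ 2) ^ j).re / 2 := by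
    intro j
    have h2 : ‖(starRingEnd ℂ) (ζ ^ j) * w‖ ^ 2 = ‖w‖ ^ 2 := by simp [hζ1]
    have h3 : w ^ 2 * ((starRingEnd ℂ) ζ ^ 2) ^ j = ((starRingEnd ℂ) (ζ ^ j) * w) ^ 2 := by
      rw [map_pow]; ring
    rw [h3, ← h2, Complex.inner, ← Complex.normSq_eq_norm_sq, Complex.normSq_apply, mul_comm w]
    simp only [pow_two, Complex.mul_re, Complex.mul_im]
    ring
  have h4 : ∑ j ∈ Finset.range n, ((starRingEnd ℂ) ζ ^ 2) ^ j = 0 := by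
    rw [geom_sum_eq]
    · rw [pow_right_comm, ← map_pow, hζ]; simp
    · rw [← map_pow]
      exact fun h => hζ2 (by simpa using congrArg (starRingEnd ℂ) h)
  simp_rw [h1]
  rw [Finset.sum_add_distrib, ← Finset.sum_div _ _ (2 : ℝ), ← Finset.sum_div _ _ (2 : ℝ),
    ← Complex.re_sum, ← Finset.mul_sum, h4]
  simp

theorem sum_one_sub_cos_inner_ge_of_norm_le {n : ℕ} {ζ : ℂ} (hζ : ζ ^ n = 1) (hζ1 : ‖ζ‖ = 1)
    (hζ2 : ζ ^ 2 ≠ 1) {w : ℂ} (hw : ‖w‖ ≤ Real.pi) :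
    n * ‖w‖ ^ 2 / Real.pi ^ 2 ≤
      ∑ j ∈ Finset.range n, (1 - Real.cos (inner ℝ (ζ ^ j) w)) := by
  have h1 : ∀ j ∈ Finset.range n,
      2 / Real.pi ^ 2 * inner ℝ (ζ ^ j) w ^ 2 ≤ 1 - Real.cos (inner ℝ (ζ ^ j) w) := by
    intro j _
    have h2 : |inner ℝ (ζ ^ j) w| ≤ Real.pi := by
      refine (abs_real_inner_le_norm _ _).trans ?_
      simpa [hζ1] using hw
    linarith [Real.cos_le_one_sub_mul_cos_sq h2]
  refine le_trans (le_of_eq ?_) (Finset.sum_le_sum h1)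
  rw [← Finset.mul_sum, sum_inner_pow_sq hζ hζ1 hζ2]
  ring

/-- This is the parallelogram law for `e^{ia} - 1` and `e^{ib} - 1`, since `|e^{ia} - 1|² = 2(1 -
cos a)`; the squares given to `nlinarith` make up the discarded term. -/
theorem one_sub_cos_sub_le (a b : ℝ) :
    1 - Real.cos (a - b) ≤ 2 * ((1 - Real.cos a) + (1 - Real.cos b)) := by
  rw [Real.cos_sub]
  nlinarith [sq_nonneg (Real.cos a + Real.cos b - 2), sq_nonneg (Real.sin a + Real.sin b),
    Real.sin_sq_add_cos_sq a, Real.sin_sq_add_cos_sq b]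

/-- The phase at `conj(ζ^h - 1) w` is the difference of the phases at `j + h` and `j`, and the
shifted sum equals the original one by periodicity. This trades a large frequency for a smaller one.
-/
theorem sum_one_sub_cos_inner_ge_shift {n : ℕ} {ζ : ℂ} (hζ : ζ ^ n = 1) (h : ℕ) (w : ℂ) :
    (∑ j ∈ Finset.range n, (1 - Real.cos (inner ℝ (ζ ^ j) ((starRingEnd ℂ) (ζ ^ h - 1) * w)))) / 4 ≤
      ∑ j ∈ Finset.range n, (1 - Real.cos (inner ℝ (ζ ^ j) w)) := by
  have h1 : ∀ j ∈ Finset.range n,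
      1 - Real.cos (inner ℝ (ζ ^ j) ((starRingEnd ℂ) (ζ ^ h - 1) * w)) ≤
        2 * ((1 - Real.cos (inner ℝ (ζ ^ (j + h)) w)) + (1 - Real.cos (inner ℝ (ζ ^ j) w))) := by
    intro j _
    refine le_trans (le_of_eq ?_) (one_sub_cos_sub_le _ _)
    congr 2
    simp only [Complex.inner, map_sub, map_mul, map_pow, map_one, pow_add, ← Complex.sub_re]
    congr 1
    ring
  have h2 := Finset.sum_le_sum h1
  rw [← Finset.mul_sum, Finset.sum_add_distrib,
    sum_range_pow_add_eq hζ (fun z => 1 - Real.cos (inner ℝ z w))] at h2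
  linarith

theorem exists_exp_pow_eq_exp_gcd {n : ℕ} (hn : n ≠ 0) (k a : ℕ) :
    ∃ h : ℕ, Complex.exp (2 * Real.pi * Complex.I * k / n) ^ h =
      Complex.exp (Complex.I * ((2 * Real.pi * (k.gcd n) * a / n : ℝ) : ℂ)) := by
  have hn' : (n : ℤ) ≠ 0 := by exact_mod_cast hn
  -- Bézout's coefficient solves the congruence; it is reduced modulo `n` because the exponent must
  -- be a natural number.
  set y : ℤ := k.gcdA n * a
  refine ⟨(y % n).toNat, ?_⟩
  have h1 : ((y % n).toNat : ℤ) = y % n := Int.toNat_of_nonneg (Int.emod_nonneg _ hn')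
  have h2 : (k : ℤ) * (y % n) = k.gcd n * a + n * (- k.gcdB n * a - k * (y / n)) := by
    rw [Int.emod_def, Nat.gcd_eq_gcd_ab]
    simp only [y]
    ring
  have h3 : (k : ℂ) * ((y % n).toNat : ℂ) =
      k.gcd n * a + n * ((- k.gcdB n * a - k * (y / n) : ℤ) : ℂ) := by
    rw [← h1] at h2
    exact_mod_cast h2
  have hn'' : (n : ℂ) ≠ 0 := by exact_mod_cast hn
  rw [← Complex.exp_nat_mul, Complex.exp_eq_exp_iff_exists_int]
  refine ⟨- k.gcdB n * a - k * (y / n), ?_⟩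
  push_cast at h3 ⊢
  field_simp
  linear_combination h3

theorem exists_norm_exp_pow_sub_one_mem {n : ℕ} (hn : n ≠ 0) (k : ℕ) {R : ℝ} (hR : 1 ≤ R)
    (hRn : 2 * Real.pi * R * k.gcd n ≤ n) :
    ∃ h : ℕ, 1 / (Real.pi * R) ≤ ‖Complex.exp (2 * Real.pi * Complex.I * k / n) ^ h - 1‖ ∧
      ‖Complex.exp (2 * Real.pi * Complex.I * k / n) ^ h - 1‖ ≤ 1 / R := by
  have hπ := Real.pi_gt_three
  have hg : 0 < k.gcd n := Nat.gcd_pos_of_pos_right _ (Nat.pos_of_ne_zero hn)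
  have hn0 : (0 : ℝ) < n := by exact_mod_cast Nat.pos_of_ne_zero hn
  have hg0 : (0 : ℝ) < k.gcd n := by exact_mod_cast hg
  -- The multiple `D` of the basic angle `2π gcd(k,n)/n` would be exactly `1/R`. As `D ≥ 1`,
  -- rounding down loses at most a factor 2.
  set D : ℝ := n / (2 * Real.pi * R * k.gcd n) with hD
  have hD1 : 1 ≤ D := (one_le_div (by positivity)).2 hRn
  obtain ⟨h, hh⟩ := exists_exp_pow_eq_exp_gcd hn k ⌊D⌋₊
  have ha1 : (⌊D⌋₊ : ℝ) ≤ D := Nat.floor_le (by linarith)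
  have ha2 : D / 2 ≤ ⌊D⌋₊ := by
    have h1 : D < ⌊D⌋₊ + 1 := Nat.lt_floor_add_one D
    have h2 : (1 : ℝ) ≤ ⌊D⌋₊ := by exact_mod_cast (Nat.one_le_floor_iff D).2 hD1
    linarith
  set θ : ℝ := 2 * Real.pi * (k.gcd n) * ⌊D⌋₊ / n with hθ
  have hnD : (n : ℝ) = D * (2 * Real.pi * R * k.gcd n) := by rw [hD]; field_simp
  have hθ1 : θ = ⌊D⌋₊ / D / R := by
    rw [hθ, hnD]; field_simp
  have hθ2 : θ ≤ 1 / R := by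
    rw [hθ1]
    gcongr
    exact (div_le_one (by linarith)).2 ha1
  have hθ3 : 1 / 2 / R ≤ θ := by
    rw [hθ1]
    refine div_le_div_of_nonneg_right ?_ (by linarith)
    rw [le_div_iff₀ (by linarith)]
    linarith
  have hθ0 : 0 ≤ θ := le_trans (by positivity) hθ3
  have hR1 : 1 / R ≤ 1 := (div_le_one (by linarith)).2 hR
  refine ⟨h, ?_, ?_⟩
  · rw [hh, Complex.norm_exp_I_mul_ofReal_sub_one]
    have h5 : 2 / Real.pi * (θ / 2) ≤ Real.sin (θ / 2) :=
      Real.mul_le_sin (by linarith) (by linarith)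
    refine le_trans ?_ (le_abs_self _)
    calc 1 / (Real.pi * R) = 2 * (2 / Real.pi * ((1 / 2 / R) / 2)) := by field_simp
      _ ≤ 2 * (2 / Real.pi * (θ / 2)) := by gcongr
      _ ≤ _ := by linarith
  · rw [hh]
    refine Real.norm_exp_I_mul_ofReal_sub_one_le.trans ?_
    rwa [Real.norm_of_nonneg hθ0]

theorem norm_exp_two_pi_mul_div (n k : ℕ) :
    ‖Complex.exp (2 * Real.pi * Complex.I * k / n)‖ = 1 := by
  have h : (2 * Real.pi * Complex.I * k / n : ℂ) = ((2 * Real.pi * k / n : ℝ) : ℂ) * Complex.I := by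
    push_cast; ring
  rw [h, Complex.norm_exp_ofReal_mul_I]

theorem exp_two_pi_mul_div_pow {n : ℕ} (hn : n ≠ 0) (k : ℕ) :
    Complex.exp (2 * Real.pi * Complex.I * k / n) ^ n = 1 := by
  have hn' : (n : ℂ) ≠ 0 := by exact_mod_cast hn
  rw [← Complex.exp_nat_mul, Complex.exp_eq_one_iff]
  exact ⟨k, by push_cast; field_simp⟩

theorem sum_one_sub_cos_inner_ge_of_one_le {n : ℕ} (hn : n ≠ 0) (k : ℕ)
    (hζ2 : Complex.exp (2 * Real.pi * Complex.I * k / n) ^ 2 ≠ 1) {w : ℂ} (hw : 1 ≤ ‖w‖)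
    (hwn : 2 * Real.pi * ‖w‖ * k.gcd n ≤ n) :
    n / (4 * Real.pi ^ 4) ≤ ∑ j ∈ Finset.range n,
      (1 - Real.cos (inner ℝ (Complex.exp (2 * Real.pi * Complex.I * k / n) ^ j) w)) := by
  obtain ⟨h, h1, h2⟩ := exists_norm_exp_pow_sub_one_mem hn k hw hwn
  set ζ := Complex.exp (2 * Real.pi * Complex.I * k / n)
  have hζ : ζ ^ n = 1 := exp_two_pi_mul_div_pow hn k
  have hζ1 : ‖ζ‖ = 1 := norm_exp_two_pi_mul_div n k
  have hw0 : 0 < ‖w‖ := by linarith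
  have hπ := Real.pi_gt_three
  have h3 : ‖(starRingEnd ℂ) (ζ ^ h - 1) * w‖ = ‖ζ ^ h - 1‖ * ‖w‖ := by
    rw [norm_mul, RCLike.norm_conj]
  have h4 : ‖(starRingEnd ℂ) (ζ ^ h - 1) * w‖ ≤ Real.pi := by
    rw [h3]
    calc _ ≤ 1 / ‖w‖ * ‖w‖ := by gcongr
      _ = 1 := by field_simp
      _ ≤ _ := by linarith
  have h5 : 1 / Real.pi ≤ ‖(starRingEnd ℂ) (ζ ^ h - 1) * w‖ := by
    rw [h3]
    calc 1 / Real.pi = 1 / (Real.pi * ‖w‖) * ‖w‖ := by field_simp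
      _ ≤ _ := by gcongr
  refine le_trans ?_ (sum_one_sub_cos_inner_ge_shift hζ h w)
  calc (n : ℝ) / (4 * Real.pi ^ 4) = (n * (1 / Real.pi) ^ 2 / Real.pi ^ 2) / 4 := by field_simp
    _ ≤ (n * ‖(starRingEnd ℂ) (ζ ^ h - 1) * w‖ ^ 2 / Real.pi ^ 2) / 4 := by gcongr
    _ ≤ _ := by
      gcongr
      exact sum_one_sub_cos_inner_ge_of_norm_le hζ hζ1 hζ2 h4

/-! ### Esseen's inequality -/

section Esseen

variable {E : Type*} [NormedAddCommGroup E] [InnerProductSpace ℝ E] [FiniteDimensional ℝ E]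
  [MeasurableSpace E] [BorelSpace E]

theorem integral_charFun_comm (κ ν : Measure E) [IsFiniteMeasure κ] [IsFiniteMeasure ν] :
    ∫ x, charFun κ x ∂ν = ∫ u, charFun ν u ∂κ := by
  simp only [charFun_apply]
  rw [integral_integral_swap]
  · simp_rw [real_inner_comm]
  · refine Integrable.of_bound (C := 1) (by fun_prop) (ae_of_all _ fun p => ?_)
    simp [Function.uncurry, Complex.norm_exp_ofReal_mul_I]

/-- Since `‖charFun κ‖²` is the characteristic function of the law of `u - u'`, with `u, u'`
independent of law `κ`, Fubini moves the transform onto `ν`. -/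
theorem integral_norm_charFun_sq_le (κ ν : Measure E) [IsProbabilityMeasure κ]
    [IsProbabilityMeasure ν] :
    ∫ x, ‖charFun κ x‖ ^ 2 ∂ν ≤ ∫ u, ∫ u', ‖charFun ν (u - u')‖ ∂κ ∂κ := by
  have hneg : ∀ x, charFun (κ.map (fun y => -y)) x = (starRingEnd ℂ) (charFun κ x) := by
    intro x
    have := charFun_map_smul (μ := κ) (-1) x
    rw [← charFun_neg]
    simpa using this
  have : IsProbabilityMeasure (κ.map (fun y => -y)) :=
    Measure.isProbabilityMeasure_map (by fun_prop)
  have hmeas : Measurable fun u => ‖charFun ν u‖ := measurable_charFun.norm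
  have h1 : ∀ x, charFun (κ.conv (κ.map (fun y => -y))) x = ((‖charFun κ x‖ ^ 2 : ℝ) : ℂ) := by
    intro x
    rw [charFun_conv, hneg, Complex.mul_conj']
    norm_cast
  have h2 := integral_charFun_comm (κ.conv (κ.map (fun y => -y))) ν
  simp_rw [h1] at h2
  rw [integral_complex_ofReal] at h2
  have h3 : ∫ x, ‖charFun κ x‖ ^ 2 ∂ν ≤ ∫ u, ‖charFun ν u‖ ∂(κ.conv (κ.map (fun y => -y))) := by
    calc ∫ x, ‖charFun κ x‖ ^ 2 ∂ν ≤ ‖((∫ x, ‖charFun κ x‖ ^ 2 ∂ν : ℝ) : ℂ)‖ := by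
          rw [Complex.norm_real]; exact le_abs_self _
      _ ≤ _ := by rw [h2]; exact norm_integral_le_integral_norm _
  refine h3.trans (le_of_eq ?_)
  rw [integral_conv]
  · refine integral_congr_ae (ae_of_all _ fun u => ?_)
    simp only
    rw [integral_map (by fun_prop) (by fun_prop)]
    simp only [sub_eq_add_neg]
  · exact Integrable.of_bound (C := 1) hmeas.aestronglyMeasurable
      (ae_of_all _ fun u => by simpa using norm_charFun_le_one u)

theorem half_le_norm_charFun (κ : Measure E) [IsProbabilityMeasure κ] {t : ℝ} (ht : 0 < t)
    (hκ : ∀ᵐ u ∂κ, ‖u‖ ≤ 1 / (2 * t)) {x : E} (hx : ‖x‖ ≤ t) : 1 / 2 ≤ ‖charFun κ x‖ := by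
  have h_int : Integrable (fun u => Complex.exp (inner ℝ u x * Complex.I)) κ :=
    Integrable.of_bound (C := 1) (by fun_prop)
      (ae_of_all _ fun u => by simp [Complex.norm_exp_ofReal_mul_I])
  have h1 : ‖charFun κ x - 1‖ ≤ 1 / 2 := by
    have h2 : charFun κ x - 1 = ∫ u, (Complex.exp (inner ℝ u x * Complex.I) - 1) ∂κ := by
      rw [integral_sub h_int (integrable_const _)]
      simp [charFun_apply]
    rw [h2]
    refine (norm_integral_le_of_norm_le_const (C := 1 / 2) ?_).trans (by simp)
    filter_upwards [hκ] with u hu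
    rw [mul_comm]
    refine Real.norm_exp_I_mul_ofReal_sub_one_le.trans ?_
    refine (norm_inner_le_norm u x).trans ?_
    calc ‖u‖ * ‖x‖ ≤ 1 / (2 * t) * t := by gcongr
      _ = 1 / 2 := by field_simp
  have h3 := norm_sub_norm_le (1 : ℂ) (1 - charFun κ x)
  rw [norm_sub_rev 1] at h3
  simp only [norm_one, sub_sub_cancel] at h3
  linarith

theorem measureReal_closedBall_le (κ ν : Measure E) [IsProbabilityMeasure κ]
    [IsProbabilityMeasure ν] {t : ℝ} (ht : 0 < t) (hκ : ∀ᵐ u ∂κ, ‖u‖ ≤ 1 / (2 * t)) :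
    ν.real (Metric.closedBall 0 t) ≤ 4 * ∫ u, ∫ u', ‖charFun ν (u - u')‖ ∂κ ∂κ := by
  have h1 : ν.real (Metric.closedBall 0 t) / 4 ≤ ∫ x, ‖charFun κ x‖ ^ 2 ∂ν := by
    calc ν.real (Metric.closedBall 0 t) / 4
        = ∫ x, (Metric.closedBall 0 t).indicator (fun _ => (1 / 4 : ℝ)) x ∂ν := by
          rw [integral_indicator_const _ measurableSet_closedBall, smul_eq_mul]; ring
      _ ≤ _ := by
          refine integral_mono ?_ ?_ fun x => ?_
          · exact (integrable_const _).indicator measurableSet_closedBall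
          · exact Integrable.of_bound (C := 1) (measurable_charFun.norm.pow_const 2).aestronglyMeasurable
              (ae_of_all _ fun u => by simpa using norm_charFun_le_one u)
          · by_cases hx : x ∈ Metric.closedBall (0 : E) t
            · rw [Set.indicator_of_mem hx]
              have := half_le_norm_charFun κ ht hκ (mem_closedBall_zero_iff.1 hx)
              nlinarith
            · rw [Set.indicator_of_notMem hx]
              positivity
  linarith [integral_norm_charFun_sq_le κ ν]

/-- A form of Esseen's inequality for laws with a Gaussian bound on the characteristic function. -/
theorem measureReal_closedBall_le_of_norm_charFun_le [Nontrivial E] (ν : Measure E)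
    [IsProbabilityMeasure ν] {t a b : ℝ} (ht : 0 < t) (ha : 0 < a)
    (h : ∀ η : E, ‖η‖ ≤ 1 / t → ‖charFun ν η‖ ≤ Real.exp (-a * ‖η‖ ^ 2) + b) :
    ν.real (Metric.closedBall 0 t) ≤
      4 * ((2 * t) ^ (Module.finrank ℝ E) / (volume : Measure E).real (Metric.ball 0 1) *
        (Real.pi / a) ^ (Module.finrank ℝ E / 2 : ℝ) + b) := by
  -- The test measure is uniform on the ball of this radius: differences of its points have norm at
  -- most `1/t`, exactly the range covered by `h`.
  set r : ℝ := 1 / (2 * t) with hr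
  have hr0 : 0 < r := by positivity
  set B : Set E := Metric.ball 0 r with hB
  have hBpos : (volume : Measure E) B ≠ 0 := (Metric.measure_ball_pos _ _ hr0).ne'
  have hBfin : (volume : Measure E) B ≠ ∞ := measure_ball_lt_top.ne
  set κ : Measure E := ProbabilityTheory.cond volume B with hκdef
  have hκprob : IsProbabilityMeasure κ := cond_isProbabilityMeasure_of_finite hBpos hBfin
  have hκB : ∀ᵐ u ∂κ, u ∈ B := ae_cond_mem measurableSet_ball
  have hκ : ∀ᵐ u ∂κ, ‖u‖ ≤ 1 / (2 * t) := by
    filter_upwards [hκB] with u hu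
    exact (mem_ball_zero_iff.1 hu).le
  have hG : Integrable fun v : E => Real.exp (-a * ‖v‖ ^ 2) := by
    -- A non-integrable function has integral zero by convention, whereas the Gaussian integral is
    -- positive.
    by_contra hcon
    have := GaussianFourier.integral_rexp_neg_mul_sq_norm (V := E) ha
    rw [integral_undef hcon] at this
    have hpos : 0 < (Real.pi / a) ^ (Module.finrank ℝ E / 2 : ℝ) := by positivity
    linarith
  have hvol : (volume : Measure E).real B =
      r ^ (Module.finrank ℝ E) * (volume : Measure E).real (Metric.ball 0 1) := by
    rw [measureReal_def, Measure.addHaar_ball _ _ hr0.le, ENNReal.toReal_mul,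
      ENNReal.toReal_ofReal (by positivity)]
    rfl
  have hκint : ∀ f : E → ℝ, ∫ u, f u ∂κ = ((volume : Measure E).real B)⁻¹ * ∫ u in B, f u := by
    intro f
    rw [hκdef, ProbabilityTheory.cond, integral_smul_measure]
    simp [measureReal_def]
  have hin : ∀ u ∈ B, ∫ u', ‖charFun ν (u - u')‖ ∂κ ≤
      (2 * t) ^ (Module.finrank ℝ E) / (volume : Measure E).real (Metric.ball 0 1) *
        (Real.pi / a) ^ (Module.finrank ℝ E / 2 : ℝ) + b := by
    intro u hu
    have hGu : Integrable fun u' : E => Real.exp (-a * ‖u - u'‖ ^ 2) := hG.comp_sub_left u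
    have hGκ : Integrable (fun u' : E => Real.exp (-a * ‖u - u'‖ ^ 2)) κ :=
      Integrable.of_bound (C := 1) (by fun_prop) (ae_of_all _ fun u' => by
        rw [Real.norm_of_nonneg (Real.exp_nonneg _), Real.exp_le_one_iff]
        have : 0 ≤ a * ‖u - u'‖ ^ 2 := by positivity
        linarith)
    calc ∫ u', ‖charFun ν (u - u')‖ ∂κ ≤ ∫ u', (Real.exp (-a * ‖u - u'‖ ^ 2) + b) ∂κ := by
          refine integral_mono_ae ?_ (hGκ.add (integrable_const _)) ?_
          · exact Integrable.of_bound (C := 1)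
              (measurable_charFun.comp (by fun_prop : Measurable fun u' : E => u - u')).norm.aestronglyMeasurable
              (ae_of_all _ fun u => by simpa using norm_charFun_le_one _)
          · filter_upwards [hκB] with u' hu'
            apply h
            refine (norm_sub_le _ _).trans ?_
            have h1 := mem_ball_zero_iff.1 hu
            have h2 := mem_ball_zero_iff.1 hu'
            have h3 : 1 / t = r + r := by rw [hr]; field_simp; norm_num
            linarith
      _ = ((volume : Measure E).real B)⁻¹ * (∫ u' in B, Real.exp (-a * ‖u - u'‖ ^ 2)) + b := by
          rw [integral_add hGκ (integrable_const _), hκint]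
          simp
      _ ≤ ((volume : Measure E).real B)⁻¹ * (∫ u' : E, Real.exp (-a * ‖u - u'‖ ^ 2)) + b := by
          have := setIntegral_le_integral (s := B) hGu (ae_of_all _ fun _ => (Real.exp_nonneg _))
          gcongr
      _ = _ := by
          rw [integral_sub_left_eq_self (fun v : E => Real.exp (-a * ‖v‖ ^ 2)),
            GaussianFourier.integral_rexp_neg_mul_sq_norm ha, hvol, hr]
          congr 2
          rw [mul_inv, ← inv_pow, one_div, inv_inv, div_eq_mul_inv]
  refine (measureReal_closedBall_le κ ν ht hκ).trans ?_
  gcongr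
  set K := (2 * t) ^ (Module.finrank ℝ E) / (volume : Measure E).real (Metric.ball 0 1) *
        (Real.pi / a) ^ (Module.finrank ℝ E / 2 : ℝ) + b with hK
  calc ∫ u, ∫ u', ‖charFun ν (u - u')‖ ∂κ ∂κ ≤ ∫ _, K ∂κ := by
        refine integral_mono_of_nonneg (ae_of_all _ fun u => integral_nonneg fun _ => norm_nonneg _)
          (integrable_const _) ?_
        filter_upwards [hκB] with u hu
        exact hin u hu
    _ = K := by simp

end Esseen

/-! ### Symmetrization and condition (H) -/

theorem norm_charFun_sq_eq_integral_cos (μ : Measure ℝ) [IsProbabilityMeasure μ] (s : ℝ) :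
    ‖charFun μ s‖ ^ 2 = ∫ p : ℝ × ℝ, Real.cos (s * (p.1 - p.2)) ∂(μ.prod μ) := by
  have h1 : ((‖charFun μ s‖ ^ 2 : ℝ) : ℂ) =
      ∫ p : ℝ × ℝ, Complex.exp ((s * (p.1 - p.2) : ℝ) * Complex.I) ∂(μ.prod μ) := by
    push_cast
    rw [← Complex.mul_conj', ← charFun_neg, charFun_apply_real, charFun_apply_real,
      ← integral_prod_mul]
    refine integral_congr_ae (ae_of_all _ fun p => ?_)
    simp only
    rw [← Complex.exp_add]
    push_cast
    ring_nf
  have h_int : Integrable (fun p : ℝ × ℝ => Complex.exp ((s * (p.1 - p.2) : ℝ) * Complex.I))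
      (μ.prod μ) :=
    Integrable.of_bound (C := 1) (by fun_prop)
      (ae_of_all _ fun p => (Complex.norm_exp_ofReal_mul_I _).le)
  have h2 := congrArg Complex.re h1
  rw [Complex.ofReal_re] at h2
  rw [h2]
  refine (integral_re h_int).symm.trans ?_
  refine integral_congr_ae (ae_of_all _ fun p => ?_)
  exact Complex.exp_ofReal_mul_I_re _

theorem integrable_one_sub_cos (μ : Measure ℝ) [IsProbabilityMeasure μ] (s : ℝ) :
    Integrable (fun p : ℝ × ℝ => 1 - Real.cos (s * (p.1 - p.2))) (μ.prod μ) :=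
  Integrable.of_bound (C := 2) (by fun_prop) (ae_of_all _ fun p => by
    rw [Real.norm_eq_abs, abs_le]
    constructor <;> linarith [Real.neg_one_le_cos (s * (p.1 - p.2)), Real.cos_le_one (s * (p.1 - p.2))])

theorem norm_charFun_le_exp (μ : Measure ℝ) [IsProbabilityMeasure μ] (s : ℝ) :
    ‖charFun μ s‖ ≤
      Real.exp (-(1 / 2) * ∫ p : ℝ × ℝ, (1 - Real.cos (s * (p.1 - p.2))) ∂(μ.prod μ)) := by
  have h_int : Integrable (fun p : ℝ × ℝ => Real.cos (s * (p.1 - p.2))) (μ.prod μ) :=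
    Integrable.of_bound (C := 1) (by fun_prop) (ae_of_all _ fun p => Real.abs_cos_le_one _)
  rw [integral_sub (integrable_const _) h_int, ← norm_charFun_sq_eq_integral_cos]
  simp only [integral_const, probReal_univ, smul_eq_mul, mul_one]
  set y := ‖charFun μ s‖
  refine le_of_sq_le_sq ?_ (Real.exp_nonneg _)
  rw [← Real.exp_nat_mul]
  calc y ^ 2 = (y ^ 2 - 1) + 1 := by ring
    _ ≤ Real.exp (y ^ 2 - 1) := Real.add_one_le_exp _
    _ = _ := by congr 1; push_cast; ring

/-- Under condition (H), the symmetrization of `μ` charges a compact set off the origin. -/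
theorem ConditionH.exists_pos_le_measureReal_prod {μ : Measure ℝ} [IsProbabilityMeasure μ]
    (hμ : ConditionH μ) : ∃ L κ : ℝ, 0 < L ∧ 0 < κ ∧
      κ ≤ (μ.prod μ).real {p : ℝ × ℝ | 1 ≤ |p.1 - p.2| ∧ |p.1 - p.2| ≤ L} := by
  obtain ⟨M, q, hM, hq0, hq1, h1, h2⟩ := hμ
  refine ⟨2 * M, q ^ 2 / 4, by positivity, by positivity, ?_⟩
  set S := {p : ℝ × ℝ | 1 ≤ |p.1 - p.2| ∧ |p.1 - p.2| ≤ 2 * M}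
  set K : Set ℝ := {x | |x| ≤ M}
  set D : Set (ℝ × ℝ) := {p | |p.1 - p.2| ≤ 1}
  have hKm : MeasurableSet K := measurableSet_le (by fun_prop) (by fun_prop)
  have hDm : MeasurableSet D := measurableSet_le (by fun_prop) (by fun_prop)
  have hK : 1 - q / 2 ≤ μ.real K := by
    have h3 : μ.real Kᶜ ≤ q / 2 := by
      refine ENNReal.toReal_le_of_le_ofReal (by positivity) ?_
      convert h2 using 2
      ext x
      simp [K]
    rw [probReal_compl_eq_one_sub hKm] at h3
    linarith
  have hD : (μ.prod μ).real D ≤ 1 - q := by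
    refine ENNReal.toReal_le_of_le_ofReal (by linarith) ?_
    rw [Measure.prod_apply hDm]
    calc ∫⁻ x, μ (Prod.mk x ⁻¹' D) ∂μ ≤ ∫⁻ _, ENNReal.ofReal (1 - q) ∂μ := by
          refine lintegral_mono fun x => ?_
          refine le_trans (le_of_eq ?_) ((le_iSup (fun u : ℝ => μ {x | |x - u| ≤ 1}) x).trans h1)
          congr 1
          ext y
          simp [D, abs_sub_comm]
      _ = _ := by simp
  have hsub : K ×ˢ K ⊆ S ∪ D := by
    rintro ⟨x, y⟩ ⟨hx, hy⟩
    simp only [K, Set.mem_ofPred_eq] at hx hy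
    by_cases hxy : |x - y| ≤ 1
    · exact Or.inr hxy
    · refine Or.inl ⟨(not_le.1 hxy).le, (abs_sub _ _).trans ?_⟩
      simp only
      linarith
  have h4 := (measureReal_mono (μ := μ.prod μ) hsub).trans (measureReal_union_le S D)
  rw [measureReal_prod_prod] at h4
  -- The constant is `(1 - q/2)² - (1 - q) = q²/4`.
  nlinarith

/-! ### Random sums of vectors -/

section RandomSum

variable {E : Type*} [NormedAddCommGroup E] [InnerProductSpace ℝ E] [FiniteDimensional ℝ E]
  [MeasurableSpace E] [BorelSpace E]
  {Ω : Type*} [MeasurableSpace Ω] {P : Measure Ω}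
  {μ : Measure ℝ} {ξ : ℕ → Ω → ℝ}

theorem charFun_map_sum_smul (hind : iIndepFun ξ P) (hlaw : ∀ j, HasLaw (ξ j) μ P)
    (n : ℕ) (v : ℕ → E) (η : E) :
    charFun (P.map (fun ω => ∑ j ∈ Finset.range n, ξ j ω • v j)) η =
      ∏ j ∈ Finset.range n, charFun μ (inner ℝ (v j) η) := by
  have hm : ∀ j, AEMeasurable (ξ j) P := fun j => (hlaw j).aemeasurable
  have hm' : ∀ j, AEMeasurable (fun ω => ξ j ω • v j) P := fun j => (hm j).smul_const _
  have hind' : iIndepFun (fun j ω => ξ j ω • v j) P :=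
    hind.comp (fun j x => x • v j) (fun j => by fun_prop)
  have h1 := iIndepFun.charFun_map_finsetSum_eq_prod (s := Finset.range n)
    (X := fun j ω => ξ j ω • v j) (fun j _ => hm' j)
    (hind'.precomp (g := fun i : Finset.range n => (i : ℕ)) Subtype.val_injective)
  have h2 : (fun ω => ∑ j ∈ Finset.range n, ξ j ω • v j) =
      ∑ j ∈ Finset.range n, fun ω => ξ j ω • v j := by
    ext ω; simp
  rw [h2, h1, Finset.prod_apply]
  refine Finset.prod_congr rfl fun j _ => ?_
  rw [charFun_apply, integral_map (hm' j) (by fun_prop), charFun_apply_real, ← (hlaw j).map_eq,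
    integral_map (hm j) (by fun_prop)]
  refine integral_congr_ae (ae_of_all _ fun ω => ?_)
  simp only [real_inner_smul_left, Complex.ofReal_mul]
  ring_nf

/-- Multiplying the bounds of `norm_charFun_le_exp` puts the cosine sum under the integral over two
independent copies. Only pairs with difference `x`, `1 ≤ |x| ≤ L`, are kept, and `x` is absorbed
into the frequency. -/
theorem norm_charFun_map_sum_smul_le [IsProbabilityMeasure μ] (hind : iIndepFun ξ P)
    (hlaw : ∀ j, HasLaw (ξ j) μ P)
    {L κ : ℝ} (hκ : κ ≤ (μ.prod μ).real {p : ℝ × ℝ | 1 ≤ |p.1 - p.2| ∧ |p.1 - p.2| ≤ L})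
    (n : ℕ) (v : ℕ → E) (η : E) {B : ℝ} (hB : 0 ≤ B)
    (h : ∀ x : ℝ, 1 ≤ |x| → |x| ≤ L →
      B ≤ ∑ j ∈ Finset.range n, (1 - Real.cos (inner ℝ (v j) (x • η)))) :
    ‖charFun (P.map (fun ω => ∑ j ∈ Finset.range n, ξ j ω • v j)) η‖ ≤
      Real.exp (-(κ * B / 2)) := by
  set S := {p : ℝ × ℝ | 1 ≤ |p.1 - p.2| ∧ |p.1 - p.2| ≤ L}
  have hS : MeasurableSet S := by
    have hm : Measurable fun p : ℝ × ℝ => |p.1 - p.2| := by fun_prop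
    exact (measurableSet_le measurable_const hm).inter (measurableSet_le hm measurable_const)
  rw [charFun_map_sum_smul hind hlaw, norm_prod]
  calc ∏ j ∈ Finset.range n, ‖charFun μ (inner ℝ (v j) η)‖
      ≤ ∏ j ∈ Finset.range n, Real.exp (-(1 / 2) *
          ∫ p : ℝ × ℝ, (1 - Real.cos (inner ℝ (v j) η * (p.1 - p.2))) ∂(μ.prod μ)) :=
        Finset.prod_le_prod (fun _ _ => norm_nonneg _) fun j _ => norm_charFun_le_exp μ _
    _ = Real.exp (-(1 / 2) * ∫ p : ℝ × ℝ, ∑ j ∈ Finset.range n,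
          (1 - Real.cos (inner ℝ (v j) η * (p.1 - p.2))) ∂(μ.prod μ)) := by
        rw [← Real.exp_sum, ← Finset.mul_sum,
          integral_finsetSum _ fun j _ => integrable_one_sub_cos μ _]
    _ ≤ _ := by
        have h1 : κ * B ≤ ∫ p : ℝ × ℝ, ∑ j ∈ Finset.range n,
            (1 - Real.cos (inner ℝ (v j) η * (p.1 - p.2))) ∂(μ.prod μ) := by
          calc κ * B ≤ (μ.prod μ).real S * B := by gcongr
            _ = ∫ p, S.indicator (fun _ => B) p ∂(μ.prod μ) := by
              rw [integral_indicator_const _ hS, smul_eq_mul]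
            _ ≤ _ := by
              refine integral_mono ((integrable_const _).indicator hS)
                (integrable_finsetSum _ fun j _ => integrable_one_sub_cos μ _) fun p => ?_
              by_cases hp : p ∈ S
              · rw [Set.indicator_of_mem hp]
                refine (h (p.1 - p.2) hp.1 hp.2).trans (le_of_eq ?_)
                simp only [real_inner_smul_right, mul_comm]
              · rw [Set.indicator_of_notMem hp]
                exact Finset.sum_nonneg fun j _ => sub_nonneg.2 (Real.cos_le_one _)
        rw [Real.exp_le_exp]
        linarith

theorem measureReal_norm_sum_smul_le [IsProbabilityMeasure P] [Nontrivial E]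
    (hξ : ∀ j, AEMeasurable (ξ j) P)
    (n : ℕ) (v : ℕ → E) {t a b : ℝ} (ht : 0 < t) (ha : 0 < a)
    (h : ∀ η : E, ‖η‖ ≤ 1 / t →
      ‖charFun (P.map (fun ω => ∑ j ∈ Finset.range n, ξ j ω • v j)) η‖ ≤
        Real.exp (-a * ‖η‖ ^ 2) + b) :
    P.real {ω | ‖∑ j ∈ Finset.range n, ξ j ω • v j‖ ≤ t} ≤
      4 * ((2 * t) ^ (Module.finrank ℝ E) / (volume : Measure E).real (Metric.ball 0 1) *
        (Real.pi / a) ^ (Module.finrank ℝ E / 2 : ℝ) + b) := by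
  have hm : AEMeasurable (fun ω => ∑ j ∈ Finset.range n, ξ j ω • v j) P :=
    Finset.aemeasurable_fun_sum _ fun j _ => (hξ j).smul_const _
  have := Measure.isProbabilityMeasure_map hm
  refine le_trans (le_of_eq ?_) (measureReal_closedBall_le_of_norm_charFun_le _ ht ha h)
  rw [map_measureReal_apply_of_aemeasurable hm measurableSet_closedBall]
  congr 1
  ext ω
  simp

end RandomSum

/-! ### Small-ball estimates for a single eigenvalue -/

section SmallBall

variable {Ω : Type*} [MeasurableSpace Ω] {P : Measure Ω} [IsProbabilityMeasure P]
  {μ : Measure ℝ} [IsProbabilityMeasure μ] {ξ : ℕ → Ω → ℝ}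

theorem measureReal_abs_sum_signed_le (hind : iIndepFun ξ P) (hlaw : ∀ j, HasLaw (ξ j) μ P)
    {L κ : ℝ} (hL : 0 < L) (hκ0 : 0 < κ)
    (hκ : κ ≤ (μ.prod μ).real {p : ℝ × ℝ | 1 ≤ |p.1 - p.2| ∧ |p.1 - p.2| ≤ L})
    {n : ℕ} (hn : n ≠ 0) {s : ℝ} (hs : s ^ 2 = 1) :
    P.real {ω | ‖∑ j ∈ Finset.range n, ξ j ω • s ^ j‖ ≤ L} ≤
      4 * (L * √(Real.pi ^ 3 / κ)) / √n := by
  have hn0 : (0 : ℝ) < n := by exact_mod_cast Nat.pos_of_ne_zero hn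
  have hπ := Real.pi_gt_three
  have h := measureReal_norm_sum_smul_le (P := P) (E := ℝ) (fun j => (hlaw j).aemeasurable) n
    (fun j => s ^ j) (t := L) (a := κ * n / Real.pi ^ 2) (b := 0) hL (by positivity) (fun η hη => by
      refine (norm_charFun_map_sum_smul_le hind hlaw hκ n _ η
        (B := n * (2 / Real.pi ^ 2 * ‖η‖ ^ 2)) (by positivity) fun x hx1 hxL => ?_).trans
        (le_of_eq ?_)
      · have h1 : ∀ j ∈ Finset.range n, 2 / Real.pi ^ 2 * ‖η‖ ^ 2 ≤
            1 - Real.cos (inner ℝ (s ^ j) (x • η)) := by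
          intro j _
          have h2 : |inner ℝ (s ^ j) (x • η)| = |x| * ‖η‖ := by
            have h3 : |s| = 1 := by
              rw [← sq_eq_sq₀ (abs_nonneg _) zero_le_one, sq_abs, hs, one_pow]
            simp [abs_mul, abs_pow, h3]
          have h4 : |x| * ‖η‖ ≤ 1 := by
            calc |x| * ‖η‖ ≤ L * (1 / L) := by gcongr
              _ = 1 := by field_simp
          have h5 := Real.cos_le_one_sub_mul_cos_sq (x := inner ℝ (s ^ j) (x • η))
            (by rw [h2]; linarith)
          rw [← sq_abs (inner ℝ _ _), h2] at h5
          have h6 : ‖η‖ ≤ |x| * ‖η‖ := le_mul_of_one_le_left (norm_nonneg _) hx1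
          have h7 : 2 / Real.pi ^ 2 * ‖η‖ ^ 2 ≤ 2 / Real.pi ^ 2 * (|x| * ‖η‖) ^ 2 := by gcongr
          linarith
        calc (n : ℝ) * (2 / Real.pi ^ 2 * ‖η‖ ^ 2)
            = ∑ j ∈ Finset.range n, 2 / Real.pi ^ 2 * ‖η‖ ^ 2 := by simp
          _ ≤ _ := Finset.sum_le_sum h1
      · rw [add_zero]
        congr 1
        ring)
  refine h.trans (le_of_eq ?_)
  have hV : (volume : Measure ℝ).real (Metric.ball 0 1) = 2 := by
    simp [measureReal_def, Real.volume_ball]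
  have h8 : Real.pi / (κ * n / Real.pi ^ 2) = (Real.pi ^ 3 / κ) / n := by field_simp
  rw [hV, Module.finrank_self, h8]
  simp only [Nat.cast_one, pow_one, add_zero]
  rw [← Real.sqrt_eq_rpow, Real.sqrt_div (by positivity)]
  ring

theorem measureReal_norm_circulantEigenvalue_le_of_sq_eq_one (hind : iIndepFun ξ P)
    (hlaw : ∀ j, HasLaw (ξ j) μ P) {L κ : ℝ} (hL : 0 < L) (hκ0 : 0 < κ)
    (hκ : κ ≤ (μ.prod μ).real {p : ℝ × ℝ | 1 ≤ |p.1 - p.2| ∧ |p.1 - p.2| ≤ L})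
    {n : ℕ} (hn : n ≠ 0) {k : ℕ} (hζ2 : Complex.exp (2 * Real.pi * Complex.I * k / n) ^ 2 = 1) :
    P.real {ω | ‖circulantEigenvalue n k (fun j => ξ j ω)‖ ≤ L} ≤
      4 * (L * √(Real.pi ^ 3 / κ)) / √n := by
  obtain ⟨s, hs, hsζ⟩ : ∃ s : ℝ, s ^ 2 = 1 ∧
      Complex.exp (2 * Real.pi * Complex.I * k / n) = (s : ℂ) := by
    rcases sq_eq_sq_iff_eq_or_eq_neg.1 (hζ2.trans (one_pow 2).symm) with h | h
    · exact ⟨1, by simp, by simp [h]⟩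
    · exact ⟨-1, by simp, by simp [h]⟩
  refine le_trans (le_of_eq ?_) (measureReal_abs_sum_signed_le hind hlaw hL hκ0 hκ hn hs)
  congr 1
  ext ω
  have : circulantEigenvalue n k (fun j => ξ j ω) =
      ((∑ j ∈ Finset.range n, ξ j ω • s ^ j : ℝ) : ℂ) := by
    simp [circulantEigenvalue, hsζ]
  rw [Set.mem_ofPred_eq, Set.mem_ofPred_eq, this, Complex.norm_real]

theorem measureReal_norm_circulantEigenvalue_le_div (hind : iIndepFun ξ P)
    (hlaw : ∀ j, HasLaw (ξ j) μ P) {L κ : ℝ} (hL : 0 < L) (hκ0 : 0 < κ)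
    (hκ : κ ≤ (μ.prod μ).real {p : ℝ × ℝ | 1 ≤ |p.1 - p.2| ∧ |p.1 - p.2| ≤ L})
    {n : ℕ} (hn : n ≠ 0) {k : ℕ} (hζ2 : Complex.exp (2 * Real.pi * Complex.I * k / n) ^ 2 ≠ 1) :
    P.real {ω | ‖circulantEigenvalue n k (fun j => ξ j ω)‖ ≤ L} ≤
      4 * ((2 * L) ^ 2 / (volume : Measure ℂ).real (Metric.ball 0 1) * (2 * Real.pi ^ 3 / κ)) / n := by
  have hn0 : (0 : ℝ) < n := by exact_mod_cast Nat.pos_of_ne_zero hn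
  have hπ := Real.pi_gt_three
  have h := measureReal_norm_sum_smul_le (P := P) (E := ℂ) (fun j => (hlaw j).aemeasurable) n
    (fun j => Complex.exp (2 * Real.pi * Complex.I * k / n) ^ j)
    (t := L) (a := κ * n / (2 * Real.pi ^ 2)) (b := 0) hL (by positivity) (fun η hη => by
      refine (norm_charFun_map_sum_smul_le hind hlaw hκ n _ η
        (B := n * ‖η‖ ^ 2 / Real.pi ^ 2) (by positivity) fun x hx1 hxL => ?_).trans
        (le_of_eq ?_)
      · have h1 : ‖x • η‖ = |x| * ‖η‖ := by rw [norm_smul, Real.norm_eq_abs]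
        have h4 : |x| * ‖η‖ ≤ 1 := by
          calc |x| * ‖η‖ ≤ L * (1 / L) := by gcongr
            _ = 1 := by field_simp
        have h6 : ‖η‖ ≤ ‖x • η‖ := h1 ▸ le_mul_of_one_le_left (norm_nonneg _) hx1
        refine le_trans ?_ (sum_one_sub_cos_inner_ge_of_norm_le (exp_two_pi_mul_div_pow hn k)
          (norm_exp_two_pi_mul_div n k) hζ2 (w := x • η) (by linarith))
        gcongr
      · rw [add_zero]
        congr 1
        ring)
  refine h.trans (le_of_eq ?_)
  have h8 : Real.pi / (κ * n / (2 * Real.pi ^ 2)) = (2 * Real.pi ^ 3 / κ) / n := by field_simp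
  rw [Complex.finrank_real_complex, h8]
  norm_num
  ring

/-- The condition on `gcd` makes the order of `ζ` large enough for every frequency `‖xη‖ ≤ L/t`. The
range `‖xη‖ ≤ 1` yields the Gaussian term, the rest the exponentially small one. -/
theorem measureReal_norm_circulantEigenvalue_le_sq (hind : iIndepFun ξ P)
    (hlaw : ∀ j, HasLaw (ξ j) μ P) {L κ : ℝ} (hκ0 : 0 < κ)
    (hκ : κ ≤ (μ.prod μ).real {p : ℝ × ℝ | 1 ≤ |p.1 - p.2| ∧ |p.1 - p.2| ≤ L})
    {n : ℕ} (hn : n ≠ 0) {k : ℕ} (hζ2 : Complex.exp (2 * Real.pi * Complex.I * k / n) ^ 2 ≠ 1)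
    {t : ℝ} (ht : 0 < t) (hkt : 2 * Real.pi * (L / t) * k.gcd n ≤ n) :
    P.real {ω | ‖circulantEigenvalue n k (fun j => ξ j ω)‖ ≤ t} ≤
      4 * ((2 * t) ^ 2 / (volume : Measure ℂ).real (Metric.ball 0 1) * (2 * Real.pi ^ 3 / κ)) / n +
        4 * Real.exp (-(κ / (8 * Real.pi ^ 4)) * n) := by
  have hn0 : (0 : ℝ) < n := by exact_mod_cast Nat.pos_of_ne_zero hn
  have hπ := Real.pi_gt_three
  have h := measureReal_norm_sum_smul_le (P := P) (E := ℂ) (fun j => (hlaw j).aemeasurable) n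
    (fun j => Complex.exp (2 * Real.pi * Complex.I * k / n) ^ j)
    (t := t) (a := κ * n / (2 * Real.pi ^ 2)) (b := Real.exp (-(κ / (8 * Real.pi ^ 4)) * n)) ht
    (by positivity) (fun η hη => by
      refine (norm_charFun_map_sum_smul_le hind hlaw hκ n _ η
        (B := min (n * ‖η‖ ^ 2 / Real.pi ^ 2) (n / (4 * Real.pi ^ 4))) (by positivity)
        fun x hx1 hxL => ?_).trans ?_
      · have h1 : ‖x • η‖ = |x| * ‖η‖ := by rw [norm_smul, Real.norm_eq_abs]
        rcases le_total ‖x • η‖ 1 with hw | hw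
        · have h6 : ‖η‖ ≤ ‖x • η‖ := h1 ▸ le_mul_of_one_le_left (norm_nonneg _) hx1
          refine (min_le_left _ _).trans (le_trans ?_
            (sum_one_sub_cos_inner_ge_of_norm_le (exp_two_pi_mul_div_pow hn k)
              (norm_exp_two_pi_mul_div n k) hζ2 (w := x • η) (by linarith)))
          gcongr
        · refine (min_le_right _ _).trans
            (sum_one_sub_cos_inner_ge_of_one_le hn k hζ2 hw (le_trans ?_ hkt))
          have h7 : ‖x • η‖ ≤ L / t := by
            rw [h1, div_eq_mul_one_div]
            gcongr
            linarith [abs_nonneg x]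
          gcongr
      · rcases min_choice (n * ‖η‖ ^ 2 / Real.pi ^ 2) (n / (4 * Real.pi ^ 4)) with hm | hm
        · rw [hm]
          refine le_add_of_le_of_nonneg (le_of_eq ?_) (Real.exp_nonneg _)
          congr 1
          ring
        · rw [hm]
          refine le_add_of_nonneg_of_le (Real.exp_nonneg _) (le_of_eq ?_)
          congr 1
          ring)
  refine h.trans (le_of_eq ?_)
  have h8 : Real.pi / (κ * n / (2 * Real.pi ^ 2)) = (2 * Real.pi ^ 3 / κ) / n := by field_simp
  rw [Complex.finrank_real_complex, h8]
  norm_num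
  ring

end SmallBall

/-! ### Counting exceptional frequencies -/

theorem card_filter_exp_sq_eq_one_le (n : ℕ) :
    ((Finset.range n).filter fun k : ℕ =>
      Complex.exp (2 * Real.pi * Complex.I * k / n) ^ 2 = 1).card ≤ 2 := by
  refine (Finset.card_le_card (t := {0, n / 2}) fun k hk => ?_).trans Finset.card_le_two
  obtain ⟨hk, h⟩ := Finset.mem_filter.1 hk
  rw [Finset.mem_range] at hk
  have hn : (n : ℂ) ≠ 0 := by exact_mod_cast (by omega : n ≠ 0)
  rw [← Complex.exp_nat_mul, Complex.exp_eq_one_iff] at h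
  obtain ⟨m, hm⟩ := h
  have h1 : (2 * k : ℤ) = m * n := by
    have h2 : (2 * k : ℂ) = m * n := by
      have h3 : (2 * Real.pi * Complex.I : ℂ) ≠ 0 := Complex.two_pi_I_ne_zero
      apply mul_left_cancel₀ h3
      push_cast at hm
      field_simp at hm ⊢
      linear_combination hm
    exact_mod_cast h2
  have h4 : m < 2 := by nlinarith
  have h5 : 0 ≤ m := by nlinarith
  simp only [Finset.mem_insert, Finset.mem_singleton]
  interval_cases m <;> omega

/-- Such a `k` is determined by the fraction `k/n` in lowest terms, whose denominator is below `R`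
and whose numerator does not exceed it. -/
theorem card_filter_lt_mul_gcd_le (n : ℕ) {R : ℝ} (hR : 0 ≤ R) :
    (((Finset.range n).filter fun k : ℕ => (n : ℝ) < R * k.gcd n).card : ℝ) ≤ (R + 1) ^ 2 := by
  have h1 : ((Finset.range n).filter fun k : ℕ => (n : ℝ) < R * k.gcd n).card ≤
      (Finset.range (⌊R⌋₊ + 1) ×ˢ Finset.range (⌊R⌋₊ + 1)).card := by
    refine Finset.card_le_card_of_injOn (fun k => (n / k.gcd n, k / k.gcd n)) ?_ ?_
    · intro k hk
      obtain ⟨hk, h⟩ := Finset.mem_filter.1 hk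
      rw [Finset.mem_range] at hk
      have hg : 0 < k.gcd n := Nat.gcd_pos_of_pos_right _ (by omega)
      have h2 : n / k.gcd n ≤ ⌊R⌋₊ := by
        refine Nat.le_floor ?_
        rw [Nat.cast_div (Nat.gcd_dvd_right _ _) (by exact_mod_cast hg.ne'),
          div_le_iff₀ (by exact_mod_cast hg)]
        exact h.le
      have h3 : k / k.gcd n ≤ n / k.gcd n := Nat.div_le_div_right hk.le
      simp only [Finset.coe_product, Set.mem_prod, Finset.mem_coe, Finset.mem_range]
      omega
    · intro k hk k' hk' h
      have hk := Finset.mem_range.1 (Finset.mem_filter.1 hk).1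
      simp only [Prod.mk.injEq] at h
      have hg : n / k.gcd n * k.gcd n = n := Nat.div_mul_cancel (Nat.gcd_dvd_right _ _)
      have hg' : n / k'.gcd n * k'.gcd n = n := Nat.div_mul_cancel (Nat.gcd_dvd_right _ _)
      have h4 : k.gcd n = k'.gcd n := by
        have h5 : 0 < n / k.gcd n := Nat.div_pos (Nat.gcd_le_right _ (by omega))
          (Nat.gcd_pos_of_pos_right _ (by omega))
        rw [← h.1] at hg'
        exact Nat.eq_of_mul_eq_mul_left h5 (hg.trans hg'.symm)
      rw [← Nat.div_mul_cancel (Nat.gcd_dvd_left k n), h.2, h4,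
        Nat.div_mul_cancel (Nat.gcd_dvd_left k' n)]
  have h6 : (⌊R⌋₊ : ℝ) ≤ R := Nat.floor_le hR
  calc _ ≤ (((Finset.range (⌊R⌋₊ + 1) ×ˢ Finset.range (⌊R⌋₊ + 1)).card : ℕ) : ℝ) := by
        exact_mod_cast h1
    _ = ((⌊R⌋₊ : ℝ) + 1) ^ 2 := by simp [sq]
    _ ≤ _ := by gcongr

/-! ### Union bound and asymptotics -/

theorem measureReal_sigmaMin_le_sum {Ω : Type*} [MeasurableSpace Ω] (P : Measure Ω)
    [IsProbabilityMeasure P] (ξ : ℕ → Ω → ℝ) {n : ℕ} (hn : n ≠ 0) (t : ℝ) :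
    P.real {ω | sigmaMin (rowCirculant n fun j => ξ j ω) ≤ t} ≤
      ∑ k ∈ Finset.range n, P.real {ω | ‖circulantEigenvalue n k (fun j => ξ j ω)‖ ≤ t} := by
  refine le_trans (measureReal_mono (fun ω hω => ?_) (measure_ne_top _ _))
    (measureReal_biUnion_finset_le (Finset.range n) _)
  obtain ⟨k, hk, h⟩ := exists_norm_circulantEigenvalue_eq n hn fun j => ξ j ω
  exact Set.mem_biUnion (Finset.mem_coe.2 (Finset.mem_range.2 hk)) (h.trans_le hω)

theorem eventually_sq_mul_rpow_add_one_le {ρ : ℝ} (hρ : ρ < 1 / 4) {c : ℝ} (hc : 0 < c) :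
    ∀ᶠ n : ℕ in atTop, (c * (n : ℝ) ^ ρ + 1) ^ 2 ≤ √n := by
  have h1 : Tendsto (fun x : ℝ => c * x ^ (-(1 / 4 - ρ)) + x ^ (-(1 / 4 : ℝ))) atTop (𝓝 (c * 0 + 0)) :=
    ((tendsto_rpow_neg_atTop (by linarith)).const_mul c).add (tendsto_rpow_neg_atTop (by norm_num))
  rw [mul_zero, add_zero] at h1
  filter_upwards [(h1.comp tendsto_natCast_atTop_atTop).eventually_le_const one_pos,
    eventually_gt_atTop 0] with n h2 hn
  have hn0 : (0 : ℝ) < n := by exact_mod_cast hn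
  have h3 : c * (n : ℝ) ^ ρ + 1 ≤ (n : ℝ) ^ (1 / 4 : ℝ) := by
    have h4 : c * (n : ℝ) ^ ρ + 1 =
        (c * (n : ℝ) ^ (-(1 / 4 - ρ)) + (n : ℝ) ^ (-(1 / 4 : ℝ))) * (n : ℝ) ^ (1 / 4 : ℝ) := by
      rw [add_mul, mul_assoc, ← Real.rpow_add hn0, ← Real.rpow_add hn0]
      norm_num
    rw [h4]
    exact mul_le_of_le_one_left (by positivity) h2
  calc (c * (n : ℝ) ^ ρ + 1) ^ 2 ≤ ((n : ℝ) ^ (1 / 4 : ℝ)) ^ 2 := by gcongr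
    _ = √n := by
      rw [← Real.rpow_natCast, ← Real.rpow_mul hn0.le, Real.sqrt_eq_rpow]
      norm_num

theorem eventually_mul_exp_neg_le_inv_sqrt {c : ℝ} (hc : 0 < c) :
    ∀ᶠ n : ℕ in atTop, (n : ℝ) * (4 * Real.exp (-c * n)) ≤ 1 / √n := by
  have h1 := ((tendsto_rpow_mul_exp_neg_mul_atTop_nhds_zero (3 / 2) c hc).const_mul 4).comp
    tendsto_natCast_atTop_atTop (α := ℕ)
  rw [mul_zero] at h1
  filter_upwards [h1.eventually_le_const one_pos, eventually_gt_atTop 0] with n h2 hn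
  have hn0 : (0 : ℝ) < n := by exact_mod_cast hn
  rw [le_div_iff₀ (by positivity)]
  refine le_trans (le_of_eq ?_) h2
  have h3 : (n : ℝ) ^ (3 / 2 : ℝ) = n * √n := by
    rw [Real.sqrt_eq_rpow, ← Real.rpow_one_add' hn0.le (by norm_num)]
    norm_num
  simp only [Function.comp_apply]
  rw [h3]
  ring

theorem sum_le_of_le_ite_add {n : ℕ} (p : ℕ → ℝ) (S T : ℕ → Prop) [DecidablePred S]
    [DecidablePred T] {a b c : ℝ}
    (h : ∀ k ∈ Finset.range n, p k ≤ (if S k then a else 0) + (if T k then b else 0) + c) :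
    ∑ k ∈ Finset.range n, p k ≤
      ((Finset.range n).filter S).card * a + ((Finset.range n).filter T).card * b + n * c := by
  refine (Finset.sum_le_sum h).trans (le_of_eq ?_)
  rw [Finset.sum_add_distrib, Finset.sum_add_distrib, ← Finset.sum_filter, ← Finset.sum_filter]
  simp

theorem mainTheorem2 (μ : Measure ℝ) [IsProbabilityMeasure μ] (hμ : ConditionH μ) :
    ∃ C : ℝ, 0 < C ∧ ∃ o : ℕ → ℝ, Tendsto o atTop (𝓝 0) ∧
      ∀ (Ω : Type*) [MeasurableSpace Ω] (P : Measure Ω) [IsProbabilityMeasure P]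
        (ξ : ℕ → Ω → ℝ), iIndepFun ξ P → (∀ j, HasLaw (ξ j) μ P) →
        ∀ ε : ℝ, 0 < ε → ∀ ρ : ℝ, 0 < ρ → ρ < 1 / 4 →
          ∀ᶠ n : ℕ in atTop,
            P.real {ω | sigmaMin (rowCirculant n fun j => ξ j ω) ≤ ε * (n : ℝ) ^ (-ρ)} ≤
              C * ((ε ^ 2 + ε) / (n : ℝ) ^ (2 * ρ) + 1 / (n : ℝ) ^ (1 / 2 - o n)) := by
  classical
  obtain ⟨L, κ, hL, hκ0, hκ⟩ := hμ.exists_pos_le_measureReal_prod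
  have hπ := Real.pi_pos
  set V := (volume : Measure ℂ).real (Metric.ball 0 1) with hV
  set C₁ := 4 * (L * √(Real.pi ^ 3 / κ)) with hC₁
  set C₂ := 4 * ((2 * L) ^ 2 / V * (2 * Real.pi ^ 3 / κ)) with hC₂
  set C₃ := 4 * (2 ^ 2 / V * (2 * Real.pi ^ 3 / κ)) with hC₃
  have hV0 : 0 ≤ V := measureReal_nonneg
  have hC₁0 : 0 ≤ C₁ := by positivity
  have hC₂0 : 0 ≤ C₂ := by positivity
  have hC₃0 : 0 ≤ C₃ := by positivity
  refine ⟨2 * C₁ + C₂ + C₃ + 1, by positivity, fun _ => 0, tendsto_const_nhds, ?_⟩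
  intro Ω _ P _ ξ hind hlaw ε hε ρ hρ0 hρ
  have hc : 0 < 2 * Real.pi * (L / ε) := by positivity
  have hlim : Tendsto (fun n : ℕ => ε * (n : ℝ) ^ (-ρ)) atTop (𝓝 (ε * 0)) :=
    ((tendsto_rpow_neg_atTop hρ0).comp tendsto_natCast_atTop_atTop).const_mul ε
  rw [mul_zero] at hlim
  filter_upwards [hlim.eventually_le_const hL, eventually_sq_mul_rpow_add_one_le hρ hc,
    eventually_mul_exp_neg_le_inv_sqrt (c := κ / (8 * Real.pi ^ 4)) (by positivity),
    eventually_gt_atTop 0] with n htL hR hexp hn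
  have hn0 : (0 : ℝ) < n := by exact_mod_cast hn
  set t := ε * (n : ℝ) ^ (-ρ) with ht
  have ht0 : 0 < t := by positivity
  set R := 2 * Real.pi * (L / t) with hRdef
  have hR' : R = 2 * Real.pi * (L / ε) * (n : ℝ) ^ ρ := by
    rw [hRdef, ht, Real.rpow_neg hn0.le]
    field_simp
  have hR0 : 0 ≤ R := by positivity
  rw [← hR'] at hR
  have hmono : ∀ k, P.real {ω | ‖circulantEigenvalue n k (fun j => ξ j ω)‖ ≤ t} ≤
      P.real {ω | ‖circulantEigenvalue n k (fun j => ξ j ω)‖ ≤ L} :=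
    fun k => measureReal_mono fun ω hω => le_trans hω htL
  have hsum := sum_le_of_le_ite_add (n := n)
    (fun k => P.real {ω | ‖circulantEigenvalue n k (fun j => ξ j ω)‖ ≤ t})
    (fun k : ℕ => Complex.exp (2 * Real.pi * Complex.I * k / n) ^ 2 = 1)
    (fun k : ℕ => (n : ℝ) < R * k.gcd n)
    (a := C₁ / √n) (b := C₂ / n)
    (c := C₃ * t ^ 2 / n + 4 * Real.exp (-(κ / (8 * Real.pi ^ 4)) * n)) (by
      intro k _
      have ha : 0 ≤ C₁ / √n := by positivity
      have hb : 0 ≤ C₂ / n := by positivity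
      have hc' : 0 ≤ C₃ * t ^ 2 / n + 4 * Real.exp (-(κ / (8 * Real.pi ^ 4)) * n) := by positivity
      by_cases h1 : Complex.exp (2 * Real.pi * Complex.I * k / n) ^ 2 = 1
      · have h3 := (hmono k).trans (measureReal_norm_circulantEigenvalue_le_of_sq_eq_one hind hlaw
          hL hκ0 hκ hn.ne' h1)
        rw [if_pos h1]
        split_ifs <;> linarith
      rw [if_neg h1]
      by_cases h2 : (n : ℝ) < R * k.gcd n
      · have h3 := (hmono k).trans (measureReal_norm_circulantEigenvalue_le_div hind hlaw
          hL hκ0 hκ hn.ne' h1)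
        rw [if_pos h2]
        linarith
      · have h3 := measureReal_norm_circulantEigenvalue_le_sq hind hlaw hκ0 hκ hn.ne' h1 ht0
          (not_lt.1 h2)
        rw [if_neg h2, zero_add, zero_add]
        refine h3.trans (le_of_eq ?_)
        rw [hC₃]
        ring)
  refine (measureReal_sigmaMin_le_sum P ξ hn.ne' t).trans (hsum.trans ?_)
  have hA : (((Finset.range n).filter fun k : ℕ =>
      Complex.exp (2 * Real.pi * Complex.I * k / n) ^ 2 = 1).card : ℝ) ≤ 2 := by
    exact_mod_cast card_filter_exp_sq_eq_one_le n
  have hB := (card_filter_lt_mul_gcd_le n hR0).trans hR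
  have hsq : √(n : ℝ) * (C₂ / n) = C₂ / √n := by
    rw [mul_div_assoc', div_eq_div_iff (by positivity) (by positivity)]
    linear_combination C₂ * Real.mul_self_sqrt hn0.le
  have ht2 : t ^ 2 = ε ^ 2 / (n : ℝ) ^ (2 * ρ) := by
    rw [ht, mul_pow, ← Real.rpow_natCast ((n : ℝ) ^ (-ρ)), ← Real.rpow_mul hn0.le, div_eq_mul_inv,
      ← Real.rpow_neg hn0.le]
    congr 2
    push_cast
    ring
  have hs : (n : ℝ) ^ (1 / 2 - 0 : ℝ) = √n := by rw [sub_zero, Real.sqrt_eq_rpow]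
  have hn1 : 0 ≤ 1 / √(n : ℝ) := by positivity
  have hn2 : 0 ≤ ε / (n : ℝ) ^ (2 * ρ) := by positivity
  have hn3 : 0 ≤ ε ^ 2 / (n : ℝ) ^ (2 * ρ) := by positivity
  rw [hs]
  calc _ ≤ 2 * (C₁ / √n) + √n * (C₂ / n) +
        n * (C₃ * t ^ 2 / n + 4 * Real.exp (-(κ / (8 * Real.pi ^ 4)) * n)) := by gcongr
    _ = (2 * C₁ + C₂) * (1 / √n) + C₃ * (ε ^ 2 / (n : ℝ) ^ (2 * ρ)) +
        n * (4 * Real.exp (-(κ / (8 * Real.pi ^ 4)) * n)) := by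
      rw [hsq, ← ht2]
      field_simp
      ring
    _ ≤ (2 * C₁ + C₂) * (1 / √n) + C₃ * (ε ^ 2 / (n : ℝ) ^ (2 * ρ)) + 1 / √n := by gcongr
    -- The term in `ε` enters only here, as a nonnegative addition.
    _ ≤ (2 * C₁ + C₂ + C₃ + 1) * (ε ^ 2 / (n : ℝ) ^ (2 * ρ) + ε / (n : ℝ) ^ (2 * ρ) + 1 / √n) := by
      nlinarith [mul_nonneg hC₃0 hn1, mul_nonneg hC₃0 hn2, mul_nonneg hC₁0 hn2,
        mul_nonneg hC₂0 hn2, mul_nonneg hC₁0 hn3, mul_nonneg hC₂0 hn3]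
    _ = _ := by ring
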